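/- Rings are associative and unital, not necessarily commutative. A topological ring is two-sided linear if its open two-sided ideals form a base of neighbourhoods of zero. Let $R$ and $S$ be complete, separated two-sided linear topological rings with countable bases of neighbourhoods of zero, and let $f\colon R\to S$ be a continuous ring homomorphism. Assume that $f$ is strongly right taut: the open two-sided ideals $I\subset R$ for which the closure of the right ideal $f(I)S\subset S$ is an open two-sided ideal of $S$ form a base of neighbourhoods of zero in $R$. For a set $X$, let $R[[X]]$ be the set of formal linear combinations $\sum_{x\in X}a_x x$ whose coefficients $a_x\in R$ converge to zero (every neighbourhood of zero contains all but finitely many $a_x$). With the unit $x\mapsto 1\cdot x$ and the multiplication $\sum_c r_c\bigl(\sum_x c_x x\bigr)\mapsto\sum_x\bigl(\sum_c r_c c_x\bigr)x$ this is a monad on the category of sets; a left $R$-contramodule is an algebra $\pi\colon R[[P]]\to P$ over it, and morphisms are morphisms of algebras. For an open right ideal $I\subset R$ let $I\curlywedge P\subset P$ be the set of all $\pi\bigl(\sum_p a_p p\bigr)$ with all $a_p\in I$; $P$ is separated if $\bigcap_I (I\curlywedge P)=0$, where $I$ runs over all open right ideals. Let $R\textrm{-Sep}$ be the full subcategory of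 separated left $R$-contramodules; define $S\textrm{-Sep}$ in the same way. Applying $f$ to coefficients gives a morphism of monads $R[[-]]\to S[[-]]$, and hence a restriction-of-scalars functor $f_\sharp\colon S\textrm{-Sep}\to R\textrm{-Sep}$. Then the following two conditions are equivalent: (1) the functor $f_\sharp\colon S\textrm{-Sep}\to R\textrm{-Sep}$ is fully faithful; (2) $f$ is a topological ring proepimorphism, that is, for every pair of open two-sided ideals $I\subset R$ and $J\subset S$ with $f(I)\subset J$, the induced homomorphism of quotient rings $R/I\to S/J$ is an epimorphism in the category of rings. -/

import Mathlib

open CategoryTheory Filter Topology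

universe u

set_option linter.unusedSectionVars false
set_option linter.unusedVariables false

namespace Contramodules

/-! ### Zero-convergent families and the functor `X ↦ R[[X]]` -/

/-- The set `R[[X]]` of formal linear combinations `∑ a_x x` whose family of coefficients converges
to zero in `R`: every neighbourhood of zero contains all but finitely many of the `a_x`. -/
@[ext]
structure ZeroFam (R : Type u) [Ring R] [TopologicalSpace R] (X : Type u) : Type u where
  /-- The family of coefficients. -/
  coeff : X → R
  tendsto_zero : Tendsto coeff cofinite (𝓝 0)

section Basic

variable {R : Type u} [Ring R] [TopologicalSpace R]

instance (X : Type u) : CoeFun (ZeroFam R X) (fun _ => X → R) := ⟨ZeroFam.coeff⟩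

theorem ZeroFam.ext' {X : Type u} {a b : ZeroFam R X} (h : ∀ x, a x = b x) : a = b :=
  ZeroFam.ext (funext h)

/-- The formal linear combination all of whose coefficients are zero. -/
def ZeroFam.zero (X : Type u) : ZeroFam R X := ⟨fun _ => 0, tendsto_const_nhds⟩

open Classical in
/-- The map `ε : X → R[[X]]` sending `x` to the formal linear combination `1 · x`. -/
noncomputable def ZeroFam.single {X : Type u} (x : X) : ZeroFam R X :=
  ⟨fun y => if y = x then 1 else 0, by
    refine tendsto_nhds_of_eventually_eq ?_
    have : {y : X | ¬ ((if y = x then (1 : R) else 0) = 0)} ⊆ {x} := by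
      intro y hy
      by_contra h
      exact hy (if_neg h)
    exact (Set.finite_singleton x).subset this⟩

end Basic

section Complete

variable {R : Type u} [Ring R] [UniformSpace R] [IsUniformAddGroup R] [IsTopologicalRing R]
  [CompleteSpace R] [T2Space R] [IsLinearTopology Rᵐᵒᵖ R]

theorem tendsto_zero_iff {ι : Type*} {a : ι → R} :
    Tendsto a cofinite (𝓝 0) ↔
      ∀ I : Submodule Rᵐᵒᵖ R, IsOpen (I : Set R) → {i | a i ∉ I}.Finite :=
  (IsLinearTopology.hasBasis_open_submodule Rᵐᵒᵖ).tendsto_right_iff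

theorem mul_mem_right {I : Submodule Rᵐᵒᵖ R} {r : R} (hr : r ∈ I) (s : R) : r * s ∈ I := by
  simpa using I.smul_mem (MulOpposite.op s) hr

theorem summable_of_tendsto {ι : Type*} {a : ι → R} (h : Tendsto a cofinite (𝓝 0)) :
    Summable a := by
  have : NonarchimedeanAddGroup R :=
    { is_nonarchimedean := fun U hU => by
        obtain ⟨I, hI, hIU⟩ := (IsLinearTopology.hasBasis_open_submodule Rᵐᵒᵖ).mem_iff.1 hU
        exact ⟨⟨I.toAddSubgroup, hI⟩, hIU⟩ }
  exact NonarchimedeanAddGroup.summable_of_tendsto_cofinite_zero h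

theorem tsum_mem {ι : Type*} {a : ι → R} {I : Submodule Rᵐᵒᵖ R} (hI : IsOpen (I : Set R))
    (h : ∀ i, a i ∈ I) : ∑' i, a i ∈ I := by
  by_cases ha : Summable a
  · have hc : IsClosed (I : Set R) := AddSubgroup.isClosed_of_isOpen I.toAddSubgroup hI
    exact hc.mem_of_tendsto ha.hasSum (Eventually.of_forall fun s => I.sum_mem fun i _ => h i)
  · rw [tsum_eq_zero_of_not_summable ha]
    exact I.zero_mem

theorem tendsto_mul_right {ι : Type*} {a : ι → R} (h : Tendsto a cofinite (𝓝 0)) (b : ι → R) :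
    Tendsto (fun i => a i * b i) cofinite (𝓝 0) := by
  rw [tendsto_zero_iff] at h ⊢
  intro I hI
  exact (h I hI).subset fun i hi hia => hi (mul_mem_right hia _)

theorem tendsto_comp_val {ι : Type*} {a : ι → R} (h : Tendsto a cofinite (𝓝 0)) (p : ι → Prop) :
    Tendsto (fun i : {i // p i} => a i) cofinite (𝓝 0) :=
  h.comp Subtype.val_injective.tendsto_cofinite

/-- If `a` is zero-convergent and every `g i` is zero-convergent, then so is the family of all
products `a i * g i j`. -/
theorem tendsto_mul_prod {ι κ : Type*} {a : ι → R} {g : ι → κ → R}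
    (ha : Tendsto a cofinite (𝓝 0)) (hg : ∀ i, Tendsto (g i) cofinite (𝓝 0)) :
    Tendsto (fun p : ι × κ => a p.1 * g p.1 p.2) cofinite (𝓝 0) := by
  rw [tendsto_zero_iff]
  intro I hI
  have h1 := tendsto_zero_iff.1 ha I hI
  have h2 : ∀ i, {j | a i * g i j ∉ I}.Finite := fun i => by
    have : Tendsto (fun j => a i * g i j) cofinite (𝓝 0) := by
      simpa using (hg i).const_mul (a i)
    exact tendsto_zero_iff.1 this I hI
  refine (h1.biUnion fun i _ => (h2 i).image (Prod.mk i)).subset ?_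
  rintro ⟨i, j⟩ hij
  simp only [Set.mem_iUnion]
  exact ⟨i, fun hi => hij (mul_mem_right hi _), j, hij, rfl⟩

theorem tendsto_tsum_mul {ι κ : Type*} {a : ι → R} {g : ι → κ → R}
    (ha : Tendsto a cofinite (𝓝 0)) (hg : ∀ i, Tendsto (g i) cofinite (𝓝 0)) :
    Tendsto (fun j => ∑' i, a i * g i j) cofinite (𝓝 0) := by
  rw [tendsto_zero_iff]
  intro I hI
  refine ((tendsto_zero_iff.1 (tendsto_mul_prod ha hg) I hI).image Prod.snd).subset ?_
  intro j hj
  by_contra hc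
  refine hj (tsum_mem hI fun i => ?_)
  by_contra hij
  exact hc ⟨(i, j), hij, rfl⟩

theorem tendsto_tsum_fiber {X Y : Type*} (f : X → Y) {a : X → R} (ha : Tendsto a cofinite (𝓝 0)) :
    Tendsto (fun y => ∑' x : {x // f x = y}, a x) cofinite (𝓝 0) := by
  rw [tendsto_zero_iff]
  intro I hI
  refine ((tendsto_zero_iff.1 ha I hI).image f).subset ?_
  intro y hy
  by_contra hc
  refine hy (tsum_mem hI fun x => ?_)
  by_contra hx
  exact hc ⟨x, hx, x.2⟩

/-- The map `R[[f]] : R[[X]] → R[[Y]]` induced by `f : X → Y`: the coefficient at `y` is the sum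
of the `a_x` over all `x` with `f x = y`. -/
noncomputable def ZeroFam.map {X Y : Type u} (f : X → Y) (a : ZeroFam R X) : ZeroFam R Y :=
  ⟨fun y => ∑' x : {x // f x = y}, a x, tendsto_tsum_fiber f a.2⟩

/-- The "opening of parentheses" `φ : R[[R[[X]]]] → R[[X]]`: the coefficient of
`∑_c r_c (∑_x c_x x)` at `x` is `∑_c r_c c_x`. -/
noncomputable def ZeroFam.join {X : Type u} (r : ZeroFam R (ZeroFam R X)) : ZeroFam R X :=
  ⟨fun x => ∑' c : ZeroFam R X, r c * c x, tendsto_tsum_mul r.2 fun c => c.2⟩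

theorem tsum_fiber {X Y : Type*} (f : X → Y) {a : X → R} (ha : Tendsto a cofinite (𝓝 0)) :
    ∑' y, ∑' x : {x // f x = y}, a x = ∑' x, a x := by
  have hs := summable_of_tendsto ha
  have hs' : Summable (fun p : (Σ y, {x // f x = y}) => a p.2) :=
    (Equiv.sigmaFiberEquiv f).summable_iff.2 hs
  rw [← (Equiv.sigmaFiberEquiv f).tsum_eq a]
  exact hs'.tsum_sigma.symm

theorem tsum_map_mul {X Y : Type u} (f : X → Y) (a : ZeroFam R X) (h : Y → R) :
    ∑' y, ZeroFam.map f a y * h y = ∑' x, a x * h (f x) := by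
  rw [← tsum_fiber f (tendsto_mul_right a.2 fun x => h (f x))]
  refine tsum_congr fun y => ?_
  change (∑' x : {x // f x = y}, a x) * h y = _
  rw [← (summable_of_tendsto (tendsto_comp_val a.2 _)).tsum_mul_right]
  exact tsum_congr fun x => by rw [x.2]

theorem map_id {X : Type u} (a : ZeroFam R X) : ZeroFam.map id a = a :=
  ZeroFam.ext' fun y => tsum_eq_single (⟨y, rfl⟩ : {x // id x = y})
    (fun x hx => (hx (Subtype.ext x.2)).elim)

theorem map_comp {X Y Z : Type u} (f : X → Y) (g : Y → Z) (a : ZeroFam R X) :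
    ZeroFam.map g (ZeroFam.map f a) = ZeroFam.map (g ∘ f) a := by
  refine ZeroFam.ext' fun z => ?_
  change ∑' y : {y // g y = z}, ∑' x : {x // f x = y}, a x = ∑' x : {x // g (f x) = z}, a x
  rw [← tsum_fiber (fun x : {x // g (f x) = z} => (⟨f x, x.2⟩ : {y // g y = z}))
    (tendsto_comp_val a.2 _)]
  refine tsum_congr fun y => ?_
  let e : {x : {x // g (f x) = z} // (⟨f x, x.2⟩ : {y // g y = z}) = y} ≃ {x // f x = y} :=
    { toFun := fun x => ⟨x.1.1, congrArg Subtype.val x.2⟩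
      invFun := fun x => ⟨⟨x.1, by rw [x.2]; exact y.2⟩, Subtype.ext x.2⟩
      left_inv := fun _ => rfl
      right_inv := fun _ => rfl }
  exact (e.tsum_eq (fun x : {x // f x = y} => a x)).symm

theorem tsum_single_mul {X : Type u} (x : X) (h : X → R) :
    ∑' y, (ZeroFam.single x : ZeroFam R X) y * h y = h x := by
  rw [tsum_eq_single x]
  · simp [ZeroFam.single]
  · intro y hy
    simp [ZeroFam.single, hy]

theorem tsum_mul_single {X : Type u} (a : ZeroFam R X) (x : X) :
    ∑' y, a y * (ZeroFam.single y : ZeroFam R X) x = a x := by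
  rw [tsum_eq_single x]
  · simp [ZeroFam.single]
  · intro y hy
    simp [ZeroFam.single, hy.symm]

theorem map_single {X Y : Type u} (f : X → Y) (x : X) :
    ZeroFam.map f (ZeroFam.single x : ZeroFam R X) = ZeroFam.single (f x) := by
  refine ZeroFam.ext' fun y => ?_
  rw [← tsum_mul_single (ZeroFam.map f _) y, tsum_map_mul, tsum_single_mul]

theorem join_single {X : Type u} (a : ZeroFam R X) :
    ZeroFam.join (ZeroFam.single a) = a :=
  ZeroFam.ext' fun x => tsum_single_mul a fun c : ZeroFam R X => c x

theorem join_map_single {X : Type u} (a : ZeroFam R X) :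
    ZeroFam.join (ZeroFam.map ZeroFam.single a) = a := by
  refine ZeroFam.ext' fun x => ?_
  change ∑' c, ZeroFam.map ZeroFam.single a c * c x = a x
  rw [tsum_map_mul _ a fun c : ZeroFam R X => c x, tsum_mul_single]

theorem tsum_join_mul {X : Type u} (r : ZeroFam R (ZeroFam R X)) (h : X → R) :
    ∑' x, ZeroFam.join r x * h x = ∑' c, r c * ∑' x, c x * h x := by
  have hp : Tendsto (fun p : ZeroFam R X × X => r p.1 * (p.1 p.2 * h p.2)) cofinite (𝓝 0) :=
    tendsto_mul_prod (g := fun (c : ZeroFam R X) x => c x * h x) r.2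
      fun c => tendsto_mul_right c.2 h
  calc ∑' x, ZeroFam.join r x * h x = ∑' x, ∑' c : ZeroFam R X, r c * (c x * h x) := by
        refine tsum_congr fun x => ?_
        change (∑' c : ZeroFam R X, r c * c x) * h x = _
        rw [← (summable_of_tendsto (tendsto_mul_right r.2 _)).tsum_mul_right]
        exact tsum_congr fun c => mul_assoc _ _ _
    _ = ∑' c : ZeroFam R X, ∑' x, r c * (c x * h x) :=
        (summable_of_tendsto hp).tsum_comm (f := fun (c : ZeroFam R X) x => r c * (c x * h x))
    _ = ∑' c : ZeroFam R X, r c * ∑' x, c x * h x := tsum_congr fun c =>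
        (summable_of_tendsto (tendsto_mul_right c.2 h)).tsum_mul_left (r c)

theorem join_join {X : Type u} (r : ZeroFam R (ZeroFam R (ZeroFam R X))) :
    ZeroFam.join (ZeroFam.map ZeroFam.join r) = ZeroFam.join (ZeroFam.join r) := by
  refine ZeroFam.ext' fun x => ?_
  change ∑' c, ZeroFam.map ZeroFam.join r c * c x = ∑' c, ZeroFam.join r c * c x
  rw [tsum_map_mul _ r fun c : ZeroFam R X => c x, tsum_join_mul r fun c : ZeroFam R X => c x]
  rfl

theorem join_map_map {X Y : Type u} (f : X → Y) (r : ZeroFam R (ZeroFam R X)) :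
    ZeroFam.join (ZeroFam.map (ZeroFam.map f) r) = ZeroFam.map f (ZeroFam.join r) := by
  refine ZeroFam.ext' fun y => ?_
  rw [← tsum_mul_single (ZeroFam.map f _) y, tsum_map_mul, tsum_join_mul]
  change ∑' c, ZeroFam.map (ZeroFam.map f) r c * c y = _
  rw [tsum_map_mul _ r fun c : ZeroFam R Y => c y]
  refine tsum_congr fun c => ?_
  rw [← tsum_map_mul f c fun z => (ZeroFam.single z : ZeroFam R Y) y, tsum_mul_single]

end Complete

/-! ### Contramodules -/

theorem hom_ext {X Y : Type u} {f g : X ⟶ Y} (h : ∀ x, f x = g x) : f = g := by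
  ext x
  exact h x

section Monad

variable (R : Type u) [Ring R] [UniformSpace R] [IsUniformAddGroup R] [IsTopologicalRing R]
  [CompleteSpace R] [T2Space R] [IsLinearTopology Rᵐᵒᵖ R]

/-- The monad `X ↦ R[[X]]` on the category of sets, for a complete, separated right linear
topological ring `R`. -/
noncomputable def contraMonad : Monad (Type u) where
  obj X := ZeroFam R X
  map f := ↾(ZeroFam.map f)
  map_id X := hom_ext fun a => map_id a
  map_comp f g := hom_ext fun a => (map_comp f g a).symm
  η := { app := fun X => ↾(ZeroFam.single)
         naturality := fun X Y f => hom_ext fun x => (map_single f x).symm }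
  μ := { app := fun X => ↾(ZeroFam.join)
         naturality := fun X Y f => hom_ext fun r => join_map_map f r }
  assoc X := hom_ext fun r => join_join r
  left_unit X := hom_ext fun a => join_single a
  right_unit X := hom_ext fun a => join_map_single a

/-- The category of left `R`-contramodules: modules over the monad `X ↦ R[[X]]`. -/
abbrev Contra : Type (u + 1) := (contraMonad R).Algebra

variable {R}

/-- The contraaction map `π : R[[P]] → P` of a left contramodule `P`. -/
def contraaction (P : Contra R) (a : ZeroFam R P.A) : P.A :=
  (ConcreteCategory.hom P.a) a

/-- The zero element of (the underlying module of) a left contramodule. -/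
def contraZero (P : Contra R) : P.A := contraaction P (ZeroFam.zero P.A)

/-- For an open right ideal `I` of `R`, the subset of `P` which is the image of `I[[P]]` under
the contraaction map. -/
def contraMul (I : Submodule Rᵐᵒᵖ R) (P : Contra R) : Set P.A :=
  {p | ∃ a : ZeroFam R P.A, (∀ x, a x ∈ I) ∧ contraaction P a = p}

/-- The nonseparatedness kernel of `P`: the intersection of `contraMul I P` over all open right
ideals `I`, that is, the kernel of the completion map `P → lim P / contraMul I P`. -/
def nonseparatednessKernel (P : Contra R) : Set P.A :=
  {p | ∀ I : Submodule Rᵐᵒᵖ R, IsOpen (I : Set R) → p ∈ contraMul I P}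

variable (R)

/-- A left contramodule is separated if its completion map is injective, that is, if its
nonseparatedness kernel is zero. -/
def isSeparated : ObjectProperty (Contra R) :=
  fun P => nonseparatednessKernel P = {contraZero P}

/-- The full subcategory of separated left contramodules. -/
abbrev Separ : Type (u + 1) := (isSeparated R).FullSubcategory

end Monad

/-! ### Restriction of scalars -/

section Restriction

variable {R S : Type u}
  [Ring R] [UniformSpace R] [IsUniformAddGroup R] [IsTopologicalRing R]
  [CompleteSpace R] [T2Space R] [IsLinearTopology Rᵐᵒᵖ R]
  [Ring S] [UniformSpace S] [IsUniformAddGroup S] [IsTopologicalRing S]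
  [CompleteSpace S] [T2Space S] [IsLinearTopology Sᵐᵒᵖ S]

/-- The map `f[[X]] : R[[X]] → S[[X]]` applying `f` to every coefficient. -/
def ZeroFam.mapCoeff (f : R →+* S) (hf : Continuous f) {X : Type u} (a : ZeroFam R X) :
    ZeroFam S X :=
  ⟨fun x => f (a x), by simpa [Function.comp_def] using (hf.tendsto 0).comp a.2⟩

theorem mapCoeff_map (f : R →+* S) (hf : Continuous f) {X Y : Type u} (g : X → Y)
    (a : ZeroFam R X) :
    ZeroFam.mapCoeff f hf (ZeroFam.map g a) = ZeroFam.map g (ZeroFam.mapCoeff f hf a) :=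
  ZeroFam.ext' fun _ =>
    (summable_of_tendsto (tendsto_comp_val a.2 _)).map_tsum f hf

theorem mapCoeff_single (f : R →+* S) (hf : Continuous f) {X : Type u} (x : X) :
    ZeroFam.mapCoeff f hf (ZeroFam.single x) = ZeroFam.single x := by
  refine ZeroFam.ext' fun y => ?_
  by_cases h : y = x <;> simp [ZeroFam.mapCoeff, ZeroFam.single, h]

theorem mapCoeff_join (f : R →+* S) (hf : Continuous f) {X : Type u}
    (r : ZeroFam R (ZeroFam R X)) :
    ZeroFam.mapCoeff f hf (ZeroFam.join r) =
      ZeroFam.join (ZeroFam.mapCoeff f hf (ZeroFam.map (ZeroFam.mapCoeff f hf) r)) := by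
  rw [mapCoeff_map]
  refine ZeroFam.ext' fun x => ?_
  change f (∑' c : ZeroFam R X, r c * c x) =
    ∑' d, ZeroFam.map (ZeroFam.mapCoeff f hf) (ZeroFam.mapCoeff f hf r) d * d x
  rw [tsum_map_mul _ _ fun d : ZeroFam S X => d x,
    (summable_of_tendsto (tendsto_mul_right r.2 _)).map_tsum f hf]
  exact tsum_congr fun c => map_mul f _ _

/-- The morphism of monads `R[[-]] → S[[-]]` induced by a continuous ring homomorphism. -/
noncomputable def contraMonadHom (f : R →+* S) (hf : Continuous f) :
    contraMonad R ⟶ contraMonad S :=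
  MonadHom.mk
    { app := fun X => ↾(ZeroFam.mapCoeff f hf)
      naturality := fun X Y g => hom_ext fun a => mapCoeff_map f hf g a }
    (fun X => hom_ext fun x => mapCoeff_single f hf x)
    (fun X => hom_ext fun r => mapCoeff_join f hf r)

/-- Restriction of scalars `S-Contra ⥤ R-Contra` along a continuous ring homomorphism. -/
noncomputable def restrictContra (f : R →+* S) (hf : Continuous f) : Contra S ⥤ Contra R :=
  Monad.algebraFunctorOfMonadHom (contraMonadHom f hf)

theorem contraaction_restrictContra (f : R →+* S) (hf : Continuous f) (P : Contra S)
    (a : ZeroFam R P.A) :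
    contraaction ((restrictContra f hf).obj P) a = contraaction P (ZeroFam.mapCoeff f hf a) :=
  rfl

theorem contraZero_restrictContra (f : R →+* S) (hf : Continuous f) (P : Contra S) :
    contraZero ((restrictContra f hf).obj P) = contraZero P :=
  congrArg (contraaction P) (ZeroFam.ext' fun _ => map_zero f)

theorem contraZero_mem (P : Contra R) : contraZero P ∈ nonseparatednessKernel P :=
  fun I _ => ⟨ZeroFam.zero P.A, fun _ => I.zero_mem, rfl⟩

theorem nonseparatednessKernel_restrictContra (f : R →+* S) (hf : Continuous f) (P : Contra S)
    {p : P.A} (hp : p ∈ nonseparatednessKernel ((restrictContra f hf).obj P)) :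
    p ∈ nonseparatednessKernel P := by
  intro J hJ
  obtain ⟨I, hI, hIJ⟩ := (IsLinearTopology.hasBasis_open_submodule Rᵐᵒᵖ).mem_iff.1
    ((hJ.preimage hf).mem_nhds (show f 0 ∈ J by rw [map_zero]; exact J.zero_mem))
  obtain ⟨a, haI, hap⟩ := hp I hI
  exact ⟨ZeroFam.mapCoeff f hf a, fun x => hIJ (haI x), hap⟩

theorem isSeparated_restrictContra (f : R →+* S) (hf : Continuous f) (P : Contra S)
    (hP : isSeparated S P) : isSeparated R ((restrictContra f hf).obj P) := by
  refine Set.Subset.antisymm (fun p hp => ?_) (Set.singleton_subset_iff.2 (contraZero_mem _))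
  have h : p ∈ nonseparatednessKernel P := nonseparatednessKernel_restrictContra f hf P hp
  have hP' : nonseparatednessKernel P = {contraZero P} := hP
  rw [hP'] at h
  exact h.trans (contraZero_restrictContra f hf P).symm

/-- Restriction of scalars `S-Separ ⥤ R-Separ` along a continuous ring homomorphism. -/
noncomputable def restrictSepar (f : R →+* S) (hf : Continuous f) : Separ S ⥤ Separ R :=
  (isSeparated R).lift ((isSeparated S).ι ⋙ restrictContra f hf)
    fun P => isSeparated_restrictContra f hf P.obj P.property

end Restriction

/-! ### Strongly right taut maps and proepimorphisms -/

section Maps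

variable {R S : Type u} [Ring R] [TopologicalSpace R] [Ring S] [TopologicalSpace S]

/-- A ring map `f : R → S` is strongly right taut if the open two-sided ideals `I` of `R`, for
which the closure of the right ideal `f(I)S` is an open two-sided ideal of `S`, form a base of
neighbourhoods of zero in `R`. -/
def StronglyRightTaut (f : R →+* S) : Prop :=
  (𝓝 (0 : R)).HasBasis
    (fun I : TwoSidedIdeal R => IsOpen (I : Set R) ∧
      ∃ J : TwoSidedIdeal S, IsOpen (J : Set S) ∧
        (J : Set S) = closure (Submodule.span Sᵐᵒᵖ (f '' (I : Set R)) : Set S))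
    (fun I : TwoSidedIdeal R => (I : Set R))

/-- The ring map `R/I → S/J` induced by `f` when `f(I) ⊆ J`. -/
def quotientMap (f : R →+* S) (I : TwoSidedIdeal R) (J : TwoSidedIdeal S)
    (h : ∀ x ∈ I, f x ∈ J) : I.ringCon.Quotient →+* J.ringCon.Quotient :=
  I.ringCon.lift (J.ringCon.mk'.comp f) fun {x y} hxy => by
    refine (RingCon.eq J.ringCon).2 ((J.rel_iff _ _).2 ?_)
    rw [← map_sub]
    exact h _ ((I.rel_iff _ _).1 hxy)

/-- `f` is a topological ring proepimorphism if for all open two-sided ideals `I`, `J` with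
`f(I) ⊆ J` the induced map `R/I → S/J` is an epimorphism in the category of rings. -/
def IsProepimorphism (f : R →+* S) : Prop :=
  ∀ (I : TwoSidedIdeal R) (J : TwoSidedIdeal S), IsOpen (I : Set R) → IsOpen (J : Set S) →
    ∀ h : ∀ x ∈ I, f x ∈ J, Epi (RingCat.ofHom (quotientMap f I J h))

end Maps

end Contramodules

/-! Restriction of scalars does not change underlying maps, so faithfulness is automatic and the
question is fullness.

Proepimorphism implies full: choose a decreasing base `I n` of open two-sided ideals of `R` such
that `J n`, the closure of `f(I n)S`, is open and two-sided. The crux is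
`idealMul_le_restrictIdealMul`: in a separated `S`-contramodule every combination with coefficients
in `J n` is already one with coefficients in `f(I n)`. This is a successive approximation as in the
open mapping theorem: completeness of `R` sums the corrections and separatedness removes the
limiting error. Consequently an `R`-morphism `g : P → Q` carries `J n`-combinations to `J
n`-combinations and descends to the quotients, which are modules over `S / J n`. Since some `R / I →
S / J n` is an epimorphism of rings, the descended map is `S`-linear (`IsProepimorphism.map_smul`).
Modulo `J n` every contraaction is a finite sum, so `g` commutes with `S`-contraactions up to `J
n`-combinations for each `n`, hence exactly.

Full implies proepimorphism: two maps from `S` to a discrete ring `T` that agree on `R` put two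
`S`-contramodule structures on `T` with the same restriction to `R`. Fullness lifts the identity of
`T`, and comparing the actions of `s` on `1` shows that the two maps coincide. -/

namespace Contramodules

/-! ### The module underlying a contramodule -/

section ModuleStructure

variable {R : Type u} [Ring R] [UniformSpace R] [IsUniformAddGroup R] [IsTopologicalRing R]
  [CompleteSpace R] [T2Space R] [IsLinearTopology Rᵐᵒᵖ R]

namespace ZeroFam

variable {X Y : Type u}

instance : Zero (ZeroFam R X) := ⟨ZeroFam.zero X⟩

instance : Add (ZeroFam R X) :=
  ⟨fun a b => ⟨fun x => a x + b x, by simpa using a.2.add b.2⟩⟩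

instance : Neg (ZeroFam R X) := ⟨fun a => ⟨fun x => -a x, by simpa using a.2.neg⟩⟩

instance : Sub (ZeroFam R X) :=
  ⟨fun a b => ⟨fun x => a x - b x, by simpa using a.2.sub b.2⟩⟩

instance : SMul R (ZeroFam R X) :=
  ⟨fun r a => ⟨fun x => r * a x, by simpa using a.2.const_mul r⟩⟩

instance : SMul ℕ (ZeroFam R X) :=
  ⟨fun n a => ⟨fun x => n • a x, by simpa using a.2.const_smul n⟩⟩

instance : SMul ℤ (ZeroFam R X) :=
  ⟨fun n a => ⟨fun x => n • a x, by simpa using a.2.const_mul (n : R)⟩⟩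

theorem coeff_injective : Function.Injective (coeff : ZeroFam R X → X → R) :=
  fun _ _ h => ZeroFam.ext h

instance : AddCommGroup (ZeroFam R X) :=
  coeff_injective.addCommGroup _ rfl (fun _ _ => rfl) (fun _ => rfl) (fun _ _ => rfl)
    (fun _ _ => rfl) (fun _ _ => rfl)

/-- The family of coefficients, as an additive map. -/
def coeffHom (R : Type u) [Ring R] [UniformSpace R] [IsUniformAddGroup R] [IsTopologicalRing R]
    [CompleteSpace R] [T2Space R] [IsLinearTopology Rᵐᵒᵖ R] (X : Type u) :
    ZeroFam R X →+ (X → R) where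
  toFun := coeff
  map_zero' := rfl
  map_add' _ _ := rfl

instance : Module R (ZeroFam R X) :=
  coeff_injective.module R (coeffHom R X) fun _ _ => rfl

@[simp] protected theorem sub_apply (a b : ZeroFam R X) (x : X) : (a - b) x = a x - b x := rfl
@[simp] protected theorem smul_apply (r : R) (a : ZeroFam R X) (x : X) : (r • a) x = r * a x := rfl

protected theorem sum_apply {ι : Type*} (s : Finset ι) (a : ι → ZeroFam R X) (x : X) :
    (∑ i ∈ s, a i) x = ∑ i ∈ s, a i x := by
  have h := congrFun (map_sum (coeffHom R X) a s) x
  rwa [Finset.sum_apply] at h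

protected theorem map_add (f : X → Y) (a b : ZeroFam R X) : map f (a + b) = map f a + map f b :=
  ZeroFam.ext' fun _ => (summable_of_tendsto (tendsto_comp_val a.2 _)).tsum_add
    (summable_of_tendsto (tendsto_comp_val b.2 _))

protected theorem map_smul (f : X → Y) (r : R) (a : ZeroFam R X) : map f (r • a) = r • map f a :=
  ZeroFam.ext' fun _ => (summable_of_tendsto (tendsto_comp_val a.2 _)).tsum_mul_left r

protected theorem map_zero (f : X → Y) : map f (0 : ZeroFam R X) = 0 :=
  ZeroFam.ext' fun _ => tsum_zero

theorem join_add (a b : ZeroFam R (ZeroFam R X)) : join (a + b) = join a + join b := by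
  refine ZeroFam.ext' fun x => ?_
  change ∑' c : ZeroFam R X, (a c + b c) * c x = _
  simp only [add_mul]
  exact (summable_of_tendsto (tendsto_mul_right a.2 _)).tsum_add
    (summable_of_tendsto (tendsto_mul_right b.2 _))

theorem join_smul (r : R) (a : ZeroFam R (ZeroFam R X)) : join (r • a) = r • join a := by
  refine ZeroFam.ext' fun x => ?_
  change ∑' c : ZeroFam R X, (r * a c) * c x = _
  simp only [mul_assoc]
  exact (summable_of_tendsto (tendsto_mul_right a.2 _)).tsum_mul_left r

theorem single_self (x : X) : (single x : ZeroFam R X) x = 1 := if_pos rfl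

theorem single_of_ne {x y : X} (h : y ≠ x) : (single x : ZeroFam R X) y = 0 := if_neg h

end ZeroFam

open ZeroFam

theorem contraaction_single (P : Contra R) (p : P.A) : contraaction P (single p) = p :=
  ConcreteCategory.congr_hom P.unit p

theorem contraaction_join (P : Contra R) (r : ZeroFam R (ZeroFam R P.A)) :
    contraaction P (join r) = contraaction P (map (contraaction P) r) :=
  ConcreteCategory.congr_hom P.assoc r

theorem contraaction_surjective (P : Contra R) : Function.Surjective (contraaction P) :=
  fun p => ⟨single p, contraaction_single P p⟩

section

variable (P : Contra R)

noncomputable instance : Zero P.A := ⟨contraaction P 0⟩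
noncomputable instance : Add P.A := ⟨fun p q => contraaction P (single p + single q)⟩
noncomputable instance : Neg P.A := ⟨fun p => contraaction P ((-1 : R) • single p)⟩
noncomputable instance : Sub P.A := ⟨fun p q => contraaction P (single p + (-1 : R) • single q)⟩
noncomputable instance : SMul R P.A := ⟨fun r p => contraaction P (r • single p)⟩
noncomputable instance : SMul ℕ P.A := ⟨fun n p => contraaction P ((n : R) • single p)⟩
noncomputable instance : SMul ℤ P.A := ⟨fun n p => contraaction P ((n : R) • single p)⟩

/-- Associativity of the contraaction at `single a + single b`, which joins to `a + b`. Analogous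
computations for the other operations let the group and module axioms descend along the surjective
contraaction. -/
theorem contraaction_add (a b : ZeroFam R P.A) :
    contraaction P (a + b) = contraaction P a + contraaction P b := by
  change _ = contraaction P (single (contraaction P a) + single (contraaction P b))
  rw [← map_single, ← map_single, ← ZeroFam.map_add, ← contraaction_join, join_add, join_single,
    join_single]

theorem contraaction_smul (r : R) (a : ZeroFam R P.A) :
    contraaction P (r • a) = r • contraaction P a := by
  change _ = contraaction P (r • single (contraaction P a))
  rw [← map_single, ← ZeroFam.map_smul, ← contraaction_join, join_smul, join_single]

noncomputable instance : AddCommGroup P.A :=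
  (contraaction_surjective P).addCommGroup _ rfl (contraaction_add P)
    (fun a => by
      change _ = contraaction P ((-1 : R) • single (contraaction P a))
      rw [← map_single, ← ZeroFam.map_smul, ← contraaction_join, join_smul, join_single,
        neg_one_smul])
    (fun a b => by
      change _ = contraaction P (single (contraaction P a) + (-1 : R) • single (contraaction P b))
      rw [← map_single, ← map_single, ← ZeroFam.map_smul, ← ZeroFam.map_add, ← contraaction_join,
        join_add, join_smul, join_single, join_single, neg_one_smul, sub_eq_add_neg])
    (fun a n => by
      change _ = contraaction P ((n : R) • single (contraaction P a))
      rw [← map_single, ← ZeroFam.map_smul, ← contraaction_join, join_smul, join_single,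
        Nat.cast_smul_eq_nsmul])
    (fun a n => by
      change _ = contraaction P ((n : R) • single (contraaction P a))
      rw [← map_single, ← ZeroFam.map_smul, ← contraaction_join, join_smul, join_single,
        Int.cast_smul_eq_zsmul])

/-- The contraaction map as an additive map. -/
def contraactionAddHom : ZeroFam R P.A →+ P.A where
  toFun := contraaction P
  map_zero' := rfl
  map_add' := contraaction_add P

noncomputable instance : Module R P.A :=
  (contraaction_surjective P).module R (contraactionAddHom P) (contraaction_smul P)

/-- The contraaction map as a linear map. -/
def contraactionHom : ZeroFam R P.A →ₗ[R] P.A where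
  toFun := contraaction P
  map_add' := contraaction_add P
  map_smul' := contraaction_smul P

theorem contraaction_sub (a b : ZeroFam R P.A) :
    contraaction P (a - b) = contraaction P a - contraaction P b :=
  _root_.map_sub (contraactionHom P) a b

theorem smul_def (r : R) (p : P.A) : r • p = contraaction P (r • single p) := rfl

/-- The set of all contraactions of families of elements of a two-sided ideal, as a submodule. -/
def idealMul (J : TwoSidedIdeal R) : Submodule R P.A where
  carrier := {p | ∃ a : ZeroFam R P.A, (∀ x, a x ∈ J) ∧ contraaction P a = p}
  zero_mem' := ⟨0, fun _ => J.zero_mem, rfl⟩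
  add_mem' := by
    rintro _ _ ⟨a, ha, rfl⟩ ⟨b, hb, rfl⟩
    exact ⟨a + b, fun x => J.add_mem (ha x) (hb x), contraaction_add P a b⟩
  smul_mem' := by
    rintro r _ ⟨a, ha, rfl⟩
    exact ⟨r • a, fun x => J.mul_mem_left _ _ (ha x), contraaction_smul P r a⟩

/-! ### Contraactions modulo an open two-sided ideal -/

variable {P}

theorem contraaction_mem_idealMul {J : TwoSidedIdeal R} {a : ZeroFam R P.A} (ha : ∀ x, a x ∈ J) :
    contraaction P a ∈ idealMul P J := ⟨a, ha, rfl⟩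

theorem smul_mem_idealMul {J : TwoSidedIdeal R} {r : R} (hr : r ∈ J) (p : P.A) :
    r • p ∈ idealMul P J :=
  contraaction_mem_idealMul (a := r • single p) fun _ => J.mul_mem_right _ _ hr

theorem contraaction_sub_mem_idealMul {J : TwoSidedIdeal R} {a b : ZeroFam R P.A}
    (h : ∀ x, a x - b x ∈ J) : contraaction P a - contraaction P b ∈ idealMul P J := by
  rw [← contraaction_sub]
  exact contraaction_mem_idealMul h

/-- A two-sided ideal, regarded as a right ideal. -/
def toRightIdeal (J : TwoSidedIdeal R) : Submodule Rᵐᵒᵖ R where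
  carrier := J
  zero_mem' := J.zero_mem
  add_mem' := J.add_mem
  smul_mem' r _ hx := J.mul_mem_right _ r.unop hx

theorem tsum_mem_ideal {ι : Type*} {J : TwoSidedIdeal R} (hJ : IsOpen (J : Set R)) {a : ι → R}
    (h : ∀ i, a i ∈ J) : ∑' i, a i ∈ J :=
  tsum_mem (I := toRightIdeal J) hJ h

/-- Modulo `J`-combinations a contraaction is a finite sum. Collecting the discarded coefficients
along the fibres of `g` stays in `J`, because an open ideal is closed and so contains its infinite
sums. -/
theorem contraaction_map_sub_sum_mem_idealMul {X : Type u} {J : TwoSidedIdeal R}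
    (hJ : IsOpen (J : Set R)) {a : ZeroFam R X} (s : Finset X) (h : ∀ x ∉ s, a x ∈ J)
    (g : X → P.A) : contraaction P (map g a) - ∑ x ∈ s, a x • g x ∈ idealMul P J := by
  classical
  -- Writing the finite sum as a contraaction too reduces the claim to a comparison of coefficients.
  have h1 : ∑ x ∈ s, a x • g x = contraaction P (map g (∑ x ∈ s, a x • single x)) := by
    let m : ZeroFam R X →+ ZeroFam R P.A := ⟨⟨map g, ZeroFam.map_zero g⟩, ZeroFam.map_add g⟩
    change _ = contraactionAddHom P (m _)
    rw [map_sum, map_sum]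
    refine Finset.sum_congr rfl fun x _ => ?_
    change _ = contraaction P (map g (a x • single x))
    rw [ZeroFam.map_smul, map_single, smul_def]
  rw [h1]
  refine contraaction_sub_mem_idealMul fun y => ?_
  have h2 : ZeroFam.map g a - ZeroFam.map g (∑ x ∈ s, a x • single x) =
      ZeroFam.map g (a - ∑ x ∈ s, a x • single x) := by
    rw [sub_eq_iff_eq_add, ← ZeroFam.map_add, sub_add_cancel]
  rw [← ZeroFam.sub_apply, h2]
  refine tsum_mem_ideal hJ fun x => ?_
  rw [ZeroFam.sub_apply, ZeroFam.sum_apply]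
  simp only [ZeroFam.smul_apply]
  by_cases hx : x.1 ∈ s
  · rw [Finset.sum_eq_single x.1 (fun y _ hy => by rw [single_of_ne hy.symm, mul_zero])
      (fun h => (h hx).elim), single_self, mul_one, sub_self]
    exact J.zero_mem
  · rw [Finset.sum_eq_zero fun y hy => by
      rw [single_of_ne (ne_of_mem_of_not_mem hy hx).symm, mul_zero], sub_zero]
    exact h _ hx

theorem finite_notMem {ι : Type*} {J : TwoSidedIdeal R} (hJ : IsOpen (J : Set R)) {a : ι → R}
    (ha : Tendsto a cofinite (𝓝 0)) : {i | a i ∉ J}.Finite :=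
  tendsto_zero_iff.1 ha (toRightIdeal J) hJ

end

end ModuleStructure

end Contramodules
namespace Contramodules

open ZeroFam

/-! ### Proepimorphisms and linearity -/

section Proepimorphism

/-- Conjugation of a ring map by a unit. -/
def conjHom {S T : Type*} [Ring S] [Ring T] (φ : S →+* T) (u : Tˣ) : S →+* T where
  toFun s := u * φ s * ↑u⁻¹
  map_one' := by simp
  map_zero' := by simp
  map_add' _ _ := by rw [map_add, mul_add, add_mul]
  map_mul' _ _ := by simp [mul_assoc]

/-- The unipotent automorphism `(m, n) ↦ (m, n + h m)` of `M × N`. -/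
def shear {M N : Type*} [AddCommGroup M] [AddCommGroup N] (h : M →+ N) :
    (AddMonoid.End (M × N))ˣ where
  val := AddMonoidHom.mk' (fun x => (x.1, x.2 + h x.1)) fun x y => by
    ext <;> simp [add_add_add_comm]
  inv := AddMonoidHom.mk' (fun x => (x.1, x.2 - h x.1)) fun x y => by
    ext <;> simp [add_sub_add_comm]
  val_inv := by
    refine AddMonoidHom.ext fun x => ?_
    change (x.1, x.2 - h x.1 + h x.1) = x
    simp
  inv_val := by
    refine AddMonoidHom.ext fun x => ?_
    change (x.1, x.2 + h x.1 - h x.1) = x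
    simp

variable {R S : Type u} [Ring R] [TopologicalSpace R] [Ring S] [TopologicalSpace S]

/-- A proepimorphism is right cancellable with respect to pairs of ring maps which vanish on an
open two-sided ideal. -/
theorem IsProepimorphism.hom_eq {f : R →+* S} (hf : Continuous f) (h : IsProepimorphism f)
    {J : TwoSidedIdeal S} (hJ : IsOpen (J : Set S)) {T : Type u} [Ring T] {φ ψ : S →+* T}
    (hφ : ∀ s ∈ J, φ s = 0) (hψ : ∀ s ∈ J, ψ s = 0) (hfφψ : ∀ r, φ (f r) = ψ (f r)) :
    φ = ψ := by
  have hlift : ∀ χ : S →+* T, (∀ s ∈ J, χ s = 0) → ∀ x y, J.ringCon x y → χ x = χ y :=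
    fun χ hχ x y hxy => sub_eq_zero.1 (by rw [← map_sub]; exact hχ _ ((J.rel_iff _ _).1 hxy))
  -- Any open ideal carried into `J` would do; the preimage of `J` is open by continuity.
  have hI : IsOpen ((J.comap f : TwoSidedIdeal R) : Set R) := by
    convert hJ.preimage hf using 1
    ext x
    simp [TwoSidedIdeal.mem_comap]
  have hepi := h (J.comap f) J hI hJ fun x hx => (TwoSidedIdeal.mem_comap f).1 hx
  have key : RingCat.ofHom (J.ringCon.lift φ fun {x y} => hlift φ hφ x y) =
      RingCat.ofHom (J.ringCon.lift ψ fun {x y} => hlift ψ hψ x y) := by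
    rw [← cancel_epi (RingCat.ofHom (quotientMap f (J.comap f) J _))]
    ext x
    exact hfφψ x
  ext s
  exact RingHom.congr_fun (congrArg RingCat.Hom.hom key) (J.ringCon.mk' s)

/-- Restriction of scalars along a proepimorphism is fully faithful on modules annihilated by an
open two-sided ideal. -/
protected theorem IsProepimorphism.map_smul {f : R →+* S} (hf : Continuous f) (hfe : IsProepimorphism f)
    {J : TwoSidedIdeal S} (hJ : IsOpen (J : Set S)) {M N : Type u} [AddCommGroup M] [Module S M]
    [AddCommGroup N] [Module S N] (hM : ∀ s ∈ J, ∀ m : M, s • m = 0)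
    (hN : ∀ s ∈ J, ∀ n : N, s • n = 0) (h : M →+ N) (hh : ∀ r m, h (f r • m) = f r • h m)
    (s : S) (m : M) : h (s • m) = s • h m := by
  let φ : S →+* AddMonoid.End (M × N) := Module.toAddMonoidEnd S (M × N)
  have hφ : ∀ s (x : M × N), φ s x = (s • x.1, s • x.2) := fun _ _ => rfl
  have hψ : ∀ s (x : M × N), conjHom φ (shear h) s x =
      (s • x.1, s • (x.2 - h x.1) + h (s • x.1)) := fun _ _ => rfl
  -- The diagonal action on `M × N` commutes with the shear by `h` exactly when `h` is linear. This
  -- is known over `f(R)`, and both actions kill `J`, so the epimorphism property extends it to `S`.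
  have key : φ = conjHom φ (shear h) := by
    refine hfe.hom_eq hf hJ (fun s hs => ?_) (fun s hs => ?_) fun r => ?_
    · refine DFunLike.ext (F := M × N →+ M × N) _ _ fun x => ?_
      refine (hφ s x).trans ?_
      rw [hM s hs, hN s hs]
      rfl
    · refine DFunLike.ext (F := M × N →+ M × N) _ _ fun x => ?_
      refine (hψ s x).trans ?_
      rw [hM s hs, hN s hs, map_zero, add_zero]
      rfl
    · refine DFunLike.ext (F := M × N →+ M × N) _ _ fun x => ?_
      refine (hφ _ x).trans (Eq.trans ?_ (hψ _ x).symm)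
      rw [hh, smul_sub, sub_add_cancel]
  have h1 := congrArg Prod.snd (DFunLike.congr_fun (RingHom.congr_fun key s) (m, 0))
  rw [hφ, hψ] at h1
  simp only [smul_zero, zero_sub, smul_neg] at h1
  exact (neg_add_eq_zero.1 h1.symm).symm

end Proepimorphism

/-! ### Taut maps and the topology of contramodules -/

section Taut

variable {R S : Type u}
  [Ring R] [UniformSpace R] [IsUniformAddGroup R] [IsTopologicalRing R]
  [CompleteSpace R] [T2Space R] [IsLinearTopology Rᵐᵒᵖ R]
  [Ring S] [UniformSpace S] [IsUniformAddGroup S] [IsTopologicalRing S]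
  [CompleteSpace S] [T2Space S] [IsLinearTopology Sᵐᵒᵖ S]

theorem eq_zero_of_forall_mem_idealMul {P : Contra S} (hP : isSeparated S P)
    {J : ℕ → TwoSidedIdeal S}
    (hJ : ∀ U : Submodule Sᵐᵒᵖ S, IsOpen (U : Set S) → ∃ n, ∀ s ∈ J n, s ∈ U) {p : P.A}
    (hp : ∀ n, p ∈ idealMul P (J n)) : p = 0 := by
  have h : p ∈ nonseparatednessKernel P := fun U hU => by
    obtain ⟨n, hn⟩ := hJ U hU
    obtain ⟨a, ha, rfl⟩ := hp n
    exact ⟨a, fun x => hn _ (ha x), rfl⟩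
  rw [show nonseparatednessKernel P = {contraZero P} from hP] at h
  exact h

variable (f : R →+* S) (hf : Continuous f)

/-- The coefficientwise application of a ring map, as an additive map. -/
def mapCoeffHom (X : Type u) : ZeroFam R X →+ ZeroFam S X where
  toFun := mapCoeff f hf
  map_zero' := ZeroFam.ext' fun _ => map_zero f
  map_add' _ _ := ZeroFam.ext' fun _ => map_add f _ _

/-- The set of contraactions of families of elements of `f(I)`. -/
def restrictIdealMul (P : Contra S) (I : TwoSidedIdeal R) : AddSubgroup P.A where
  carrier := {p | ∃ a : ZeroFam R P.A, (∀ x, a x ∈ I) ∧ contraaction P (mapCoeff f hf a) = p}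
  zero_mem' := ⟨0, fun _ => I.zero_mem,
    congrArg (contraaction P) ((mapCoeffHom f hf P.A).map_zero)⟩
  add_mem' := by
    rintro _ _ ⟨a, ha, rfl⟩ ⟨b, hb, rfl⟩
    exact ⟨a + b, fun x => I.add_mem (ha x) (hb x),
      ((contraactionAddHom P).comp (mapCoeffHom f hf P.A)).map_add a b⟩
  neg_mem' := by
    rintro _ ⟨a, ha, rfl⟩
    exact ⟨-a, fun x => I.neg_mem (ha x),
      ((contraactionAddHom P).comp (mapCoeffHom f hf P.A)).map_neg a⟩

theorem map_smul_eq_contraaction (P : Contra S) (r : R) (p : P.A) :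
    f r • p = contraaction P (mapCoeff f hf (r • single p)) := by
  rw [smul_def]
  congr 1
  refine ZeroFam.ext' fun x => ?_
  change f r * _ = f (r * _)
  rw [map_mul, ← mapCoeff_single f hf]
  rfl

/-- A right multiple `s * t` acts on `p` as `s` acts on `t • p`. Quantifying over all `p` thus
absorbs the right factor, although the subgroup is not known to be stable under `S`. -/
theorem smul_mem_restrictIdealMul {P : Contra S} {I : TwoSidedIdeal R} {s : S}
    (hs : s ∈ Submodule.span Sᵐᵒᵖ (f '' (I : Set R))) :
    ∀ p : P.A, s • p ∈ restrictIdealMul f hf P I := by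
  induction hs using Submodule.span_induction with
  | mem s hs =>
    obtain ⟨r, hr, rfl⟩ := hs
    intro p
    rw [map_smul_eq_contraaction f hf]
    exact ⟨_, fun x => I.mul_mem_right _ _ hr, rfl⟩
  | zero =>
    intro p
    rw [zero_smul]
    exact zero_mem _
  | add s t _ _ hs ht =>
    intro p
    rw [add_smul]
    exact add_mem (hs p) (ht p)
  | smul t s _ hs =>
    intro p
    rw [show t • s = s * t.unop from rfl, mul_smul]
    exact hs _

/-- One approximation step: modulo `J'` only finitely many terms survive, and density replaces each
of their coefficients by an element of `f(I)S`. -/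
theorem idealMul_le_sup {P : Contra S} {I : TwoSidedIdeal R} {J J' : TwoSidedIdeal S}
    (hJ : (J : Set S) = closure (Submodule.span Sᵐᵒᵖ (f '' (I : Set R)) : Set S))
    (hJ' : IsOpen (J' : Set S)) {p : P.A} (hp : p ∈ idealMul P J) :
    ∃ a : ZeroFam R P.A, (∀ x, a x ∈ I) ∧
      p - contraaction P (mapCoeff f hf a) ∈ idealMul P J' := by
  have key : p ∈ restrictIdealMul f hf P I ⊔ (idealMul P J').toAddSubgroup := by
    obtain ⟨a, ha, rfl⟩ := hp
    have h1 := contraaction_map_sub_sum_mem_idealMul (P := P) hJ'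
      (finite_notMem hJ' a.2).toFinset (fun x hx => by simpa using hx) id
    rw [Contramodules.map_id] at h1
    rw [← sub_add_cancel (contraaction P a)
      (∑ x ∈ (finite_notMem hJ' a.2).toFinset, a x • id x)]
    refine add_mem (AddSubgroup.mem_sup_right h1) (sum_mem fun x _ => ?_)
    have h2 : a x ∈ closure (Submodule.span Sᵐᵒᵖ (f '' (I : Set R)) : Set S) := hJ ▸ ha x
    obtain ⟨t, ht, hts⟩ := mem_closure_iff.1 h2 {t | a x - t ∈ J'}
      (hJ'.preimage (continuous_const.sub continuous_id))
      (by simp)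
    rw [← sub_add_cancel (a x) t, add_smul]
    exact add_mem (AddSubgroup.mem_sup_right (smul_mem_idealMul ht _))
      (AddSubgroup.mem_sup_left (smul_mem_restrictIdealMul f hf hts _))
  obtain ⟨_, ⟨a, ha, rfl⟩, q, hq, rfl⟩ := AddSubgroup.mem_sup.1 key
  exact ⟨a, ha, by rwa [add_sub_cancel_left]⟩

/-- The data witnessing that `f` is strongly right taut when `R` is first countable: a decreasing
base of open two-sided ideals `I n` of `R` such that the closures `J n` of `f(I n)S` are open
two-sided ideals. -/
structure TautSequence (I : ℕ → TwoSidedIdeal R) (J : ℕ → TwoSidedIdeal S) : Prop where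
  basis : (𝓝 (0 : R)).HasAntitoneBasis fun n => (I n : Set R)
  isOpen_left : ∀ n, IsOpen (I n : Set R)
  isOpen_right : ∀ n, IsOpen (J n : Set S)
  eq_closure : ∀ n,
    (J n : Set S) = closure (Submodule.span Sᵐᵒᵖ (f '' (I n : Set R)) : Set S)

theorem StronglyRightTaut.exists_tautSequence {f : R →+* S} (h : StronglyRightTaut f)
    (hR : (𝓝 (0 : R)).IsCountablyGenerated) :
    ∃ (I : ℕ → TwoSidedIdeal R) (J : ℕ → TwoSidedIdeal S), TautSequence f I J := by
  obtain ⟨I, hI, hb⟩ := HasBasis.exists_antitone_subbasis h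
  choose hI J hJ hJ' using hI
  exact ⟨I, J, hb, hI, hJ, hJ'⟩

/-! ### Successive approximation along a taut sequence -/

namespace TautSequence

variable {f} {I : ℕ → TwoSidedIdeal R} {J : ℕ → TwoSidedIdeal S}

theorem map_mem (h : TautSequence f I J) {n : ℕ} {r : R} (hr : r ∈ I n) : f r ∈ J n := by
  have : f r ∈ (J n : Set S) := by
    rw [h.eq_closure]
    exact subset_closure (Submodule.subset_span ⟨r, hr, rfl⟩)
  exact this

/-- By continuity `U` contains some `f(I n)`; being a closed right ideal, it contains the closure of
`f(I n)S`. -/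
theorem exists_le (h : TautSequence f I J) (hf : Continuous f) (U : Submodule Sᵐᵒᵖ S) (hU : IsOpen (U : Set S)) :
    ∃ n, ∀ s ∈ J n, s ∈ U := by
  obtain ⟨n, -, hn⟩ := h.basis.1.mem_iff.1
    ((hU.preimage hf).mem_nhds (show f 0 ∈ U by rw [map_zero]; exact U.zero_mem))
  refine ⟨n, fun s hs => ?_⟩
  have hs' : s ∈ (J n : Set S) := hs
  rw [h.eq_closure] at hs'
  have hc : IsClosed (U : Set S) := AddSubgroup.isClosed_of_isOpen U.toAddSubgroup hU
  refine closure_minimal ?_ hc hs'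
  exact Submodule.span_le.2 (Set.image_subset_iff.2 hn)

theorem mem_of_le (h : TautSequence f I J) {m n : ℕ} (hmn : m ≤ n) {r : R} (hr : r ∈ I n) : r ∈ I m :=
  h.basis.2 hmn hr

/-- A sequence of zero-convergent families with coefficients in `I n`, `I (n + 1)`, … can be
summed up. -/
theorem exists_sum (h : TautSequence f I J) {X : Type u} {n : ℕ} (a : ℕ → ZeroFam R X) (ha : ∀ k x, a k x ∈ I (n + k)) :
    ∃ b : ZeroFam R X, ∀ m x, b x - ∑ k ∈ Finset.range m, a k x ∈ I (n + m) := by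
  have hs : ∀ x, Summable fun k => a k x := fun x => by
    refine summable_of_tendsto ?_
    rw [Nat.cofinite_eq_atTop, h.basis.1.tendsto_right_iff]
    intro m _
    filter_upwards [eventually_ge_atTop m] with k hk
    exact h.mem_of_le (hk.trans (Nat.le_add_left k n)) (ha k x)
  have hm : ∀ m x, ∑' k, a k x - ∑ k ∈ Finset.range m, a k x ∈ I (n + m) := fun m x => by
    rw [← (hs x).sum_add_tsum_nat_add m, add_sub_cancel_left]
    exact tsum_mem_ideal (h.isOpen_left _) fun k =>
      h.mem_of_le (by omega) (ha (k + m) x)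
  refine ⟨⟨fun x => ∑' k, a k x, ?_⟩, hm⟩
  rw [tendsto_zero_iff]
  intro U hU
  -- The tail from index `m` on lies in `U` at every `x`, so only the first `m` families, each
  -- zero-convergent, can leave `U`.
  obtain ⟨m, -, hmU⟩ := h.basis.1.mem_iff.1 (hU.mem_nhds U.zero_mem)
  refine ((Finset.range m).finite_toSet.biUnion fun k _ =>
    tendsto_zero_iff.1 (a k).2 U hU).subset fun x hx => ?_
  by_contra hc
  refine hx ?_
  rw [← sub_add_cancel (∑' k, a k x) (∑ k ∈ Finset.range m, a k x)]
  refine U.add_mem (hmU (h.mem_of_le (Nat.le_add_left m n) (hm m x))) (U.sum_mem fun k hk => ?_)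
  by_contra hk'
  exact hc (Set.mem_biUnion hk hk')

/-- An `I m`-correction turns an error in `J m` into one in `J (m + 1)`. The corrections, starting
from `m = n`, sum to a single zero-convergent family, and separatedness makes the final error
vanish. -/
theorem idealMul_le_restrictIdealMul (h : TautSequence f I J) {P : Contra S} (hP : isSeparated S P) {n : ℕ} {p : P.A}
    (hp : p ∈ idealMul P (J n)) : p ∈ restrictIdealMul f hf P (I n) := by
  let c := (contraactionAddHom P).comp (mapCoeffHom f hf P.A)
  have step : ∀ m (q : P.A), q ∈ idealMul P (J m) → ∃ a : ZeroFam R P.A, (∀ x, a x ∈ I m) ∧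
      q - c a ∈ idealMul P (J (m + 1)) := fun m q hq =>
    idealMul_le_sup f hf (h.eq_closure m) (h.isOpen_right _) hq
  choose a ha hac using step
  -- `r k` is the error left after `k` corrections, and `b k` is the next correction.
  let r : (k : ℕ) → {q : P.A // q ∈ idealMul P (J (n + k))} := fun k =>
    Nat.rec ⟨p, hp⟩ (fun k q => ⟨q.1 - c (a (n + k) q.1 q.2), hac (n + k) q.1 q.2⟩) k
  let b : ℕ → ZeroFam R P.A := fun k => a (n + k) (r k).1 (r k).2
  have hr : ∀ m, p - c (∑ k ∈ Finset.range m, b k) = (r m).1 := fun m => by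
    induction m with
    | zero => simp [r]
    | succ m ih =>
      rw [Finset.sum_range_succ, map_add, ← sub_sub, ih]
  obtain ⟨d, hd⟩ := h.exists_sum b fun k x => ha _ _ _ x
  have hp0 : p - c d = 0 := by
    refine eq_zero_of_forall_mem_idealMul hP (J := fun m => J (n + m)) (fun U hU => ?_)
      fun m => ?_
    · obtain ⟨m, hm⟩ := h.exists_le hf U hU
      refine ⟨m, fun s hs => hm s ?_⟩
      have hs' : s ∈ (J (n + m) : Set S) := hs
      rw [h.eq_closure] at hs'
      have : s ∈ (J m : Set S) := by
        rw [h.eq_closure]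
        exact closure_mono (Submodule.span_mono (Set.image_mono (h.basis.2 (Nat.le_add_left m n)))) hs'
      exact this
    -- The final error is the `m`-th error minus the contribution of the remaining corrections,
    -- whose coefficients lie in `I (n + m)`.
    · rw [show p - c d = (r m).1 - c (d - ∑ k ∈ Finset.range m, b k) by
        rw [← hr, map_sub]; abel]
      refine sub_mem (r m).2 (contraaction_mem_idealMul fun x => h.map_mem ?_)
      rw [ZeroFam.sub_apply, ZeroFam.sum_apply]
      exact hd m x
  -- At `m = 0` the partial sum is empty, so `hd` places the coefficients of `d` in `I n`.
  exact ⟨d, fun x => by simpa using hd 0 x, (sub_eq_zero.1 hp0).symm⟩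

end TautSequence

end Taut

end Contramodules
namespace Contramodules

open ZeroFam

variable {R S : Type u}
  [Ring R] [UniformSpace R] [IsUniformAddGroup R] [IsTopologicalRing R]
  [CompleteSpace R] [T2Space R] [IsLinearTopology Rᵐᵒᵖ R]
  [Ring S] [UniformSpace S] [IsUniformAddGroup S] [IsTopologicalRing S]
  [CompleteSpace S] [T2Space S] [IsLinearTopology Sᵐᵒᵖ S]

/-! ### Full faithfulness of the restriction of scalars along a proepimorphism -/

/-- A map of separated `S`-contramodules which commutes with the contraactions of `R` commutes with
those of `S`. -/
theorem IsProepimorphism.map_contraaction {f : R →+* S} (hf : Continuous f)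
    (hfe : IsProepimorphism f) {I : ℕ → TwoSidedIdeal R} {J : ℕ → TwoSidedIdeal S}
    (h : TautSequence f I J) {P Q : Contra S} (hP : isSeparated S P) (hQ : isSeparated S Q)
    (g : P.A → Q.A)
    (hg : ∀ a : ZeroFam R P.A, g (contraaction P (mapCoeff f hf a)) =
      contraaction Q (mapCoeff f hf (ZeroFam.map g a))) (b : ZeroFam S P.A) :
    g (contraaction P b) = contraaction Q (ZeroFam.map g b) := by
  let c : ∀ P : Contra S, ZeroFam R P.A →+ P.A := fun P =>
    (contraactionAddHom P).comp (mapCoeffHom f hf P.A)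
  have hc : ∀ (P : Contra S) (p : P.A), c P (single p) = p := fun P p => by
    change contraaction P (mapCoeff f hf (single p)) = p
    rw [mapCoeff_single, contraaction_single]
  have hgc : ∀ a, g (c P a) = c Q (ZeroFam.map g a) := hg
  let g' : P.A →+ Q.A := AddMonoidHom.mk' g fun p q => by
    have h1 := hgc (single p + single q)
    rwa [map_add, ZeroFam.map_add, map_add, map_single, map_single, hc, hc, hc, hc] at h1
  have hg' : ∀ p, g' p = g p := fun _ => rfl
  have hsmul : ∀ (r : R) (p : P.A), g' (f r • p) = f r • g' p := fun r p => by
    rw [map_smul_eq_contraaction f hf, map_smul_eq_contraaction f hf, hg', hg, ZeroFam.map_smul,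
      map_single, hg']
  -- Tautness enters here: once `p` is written with coefficients from `f(I n)`, its image is
  -- controlled by `R`-contralinearity alone.
  have hker : ∀ n, ∀ p ∈ idealMul P (J n), g' p ∈ idealMul Q (J n) := fun n p hp => by
    obtain ⟨a, ha, rfl⟩ := h.idealMul_le_restrictIdealMul hf hP hp
    rw [hg', hg]
    exact contraaction_mem_idealMul fun x =>
      h.map_mem (tsum_mem_ideal (h.isOpen_left n) fun y => ha y.1)
  have hlin : ∀ n (s : S) (p : P.A), g' (s • p) - s • g' p ∈ idealMul Q (J n) := fun n s p => by
    let q : (P.A ⧸ idealMul P (J n)) →+ (Q.A ⧸ idealMul Q (J n)) :=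
      QuotientAddGroup.map (idealMul P (J n)).toAddSubgroup (idealMul Q (J n)).toAddSubgroup g'
        (hker n)
    rw [← Submodule.Quotient.eq]
    refine hfe.map_smul hf (h.isOpen_right n) (fun s hs => ?_) (fun s hs => ?_) q ?_ s
      (Submodule.Quotient.mk p)
    · rintro ⟨p⟩
      exact (Submodule.Quotient.mk_eq_zero _).2 (smul_mem_idealMul hs p)
    · rintro ⟨p⟩
      exact (Submodule.Quotient.mk_eq_zero _).2 (smul_mem_idealMul hs p)
    · rintro r ⟨p⟩
      exact congrArg Submodule.Quotient.mk (hsmul r p)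
  refine sub_eq_zero.1 (eq_zero_of_forall_mem_idealMul hQ (h.exists_le hf) fun n => ?_)
  let s := (finite_notMem (h.isOpen_right n) b.2).toFinset
  have hs : ∀ x ∉ s, b x ∈ J n := fun x hx => by simpa [s] using hx
  have h1 := hker n _
    (contraaction_map_sub_sum_mem_idealMul (P := P) (h.isOpen_right n) s hs id)
  have h2 := contraaction_map_sub_sum_mem_idealMul (P := Q) (h.isOpen_right n) s hs g
  rw [Contramodules.map_id, map_sub, map_sum] at h1
  have h3 : ∑ x ∈ s, g' (b x • id x) - ∑ x ∈ s, b x • g x ∈ idealMul Q (J n) := by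
    rw [← Finset.sum_sub_distrib]
    exact sum_mem fun x _ => hlin n (b x) x
  -- The discrepancy is the `g'`-image of the tail in `P`, plus the failure of linearity on the
  -- finite part, minus the tail in `Q`.
  convert sub_mem (add_mem h1 h3) h2 using 1
  rw [hg']
  abel

theorem restrictSepar_faithful (f : R →+* S) (hf : Continuous f) :
    (restrictSepar f hf).Faithful where
  map_injective {X Y} u v huv := by
    refine ObjectProperty.hom_ext _ (Monad.Algebra.Hom.ext ?_)
    exact congrArg (fun w => w.hom.f) huv

theorem IsProepimorphism.restrictSepar_full {f : R →+* S} (hf : Continuous f)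
    (hfe : IsProepimorphism f) (htaut : StronglyRightTaut f)
    (hR : (𝓝 (0 : R)).IsCountablyGenerated) : (restrictSepar f hf).Full where
  map_surjective {X Y} u := by
    obtain ⟨I, J, h⟩ := htaut.exists_tautSequence hR
    let g : X.obj.A → Y.obj.A := ConcreteCategory.hom u.hom.f
    have hg : ∀ a : ZeroFam R X.obj.A, g (contraaction X.obj (mapCoeff f hf a)) =
        contraaction Y.obj (mapCoeff f hf (ZeroFam.map g a)) := fun a =>
      (ConcreteCategory.congr_hom u.hom.h a).symm
    have hS := hfe.map_contraaction hf h X.property Y.property g hg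
    exact ⟨ObjectProperty.homMk ⟨↾g, Contramodules.hom_ext fun b => (hS b).symm⟩, rfl⟩

/-! ### Full faithfulness implies the proepimorphism property -/

/-- In a discrete ring the zero ideal is open. -/
theorem isSeparated_of_discreteTopology [DiscreteTopology R] (P : Contra R) : isSeparated R P := by
  refine Set.Subset.antisymm (fun p hp => ?_) (Set.singleton_subset_iff.2 (contraZero_mem P))
  obtain ⟨a, ha, rfl⟩ := hp ⊥ (isOpen_discrete _)
  exact congrArg (contraaction P) (ZeroFam.ext' ha)

/-- A free contramodule on one generator over a discrete ring `T`, regarded as a separated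
contramodule over `S`. -/
noncomputable def discreteSepar {T : Type u} [Ring T] [UniformSpace T] [IsUniformAddGroup T]
    [IsTopologicalRing T] [CompleteSpace T] [T2Space T] [IsLinearTopology Tᵐᵒᵖ T]
    [DiscreteTopology T] (φ : S →+* T) (hφ : Continuous φ) : Separ S :=
  (restrictSepar φ hφ).obj ⟨(contraMonad T).free.obj PUnit, isSeparated_of_discreteTopology _⟩

/-- The identity of `T` is an `R`-morphism between the structures given by `φ` and `ψ`. Its lift has
the same underlying map, so the two `S`-contraactions agree. -/
theorem hom_eq_of_restrictSepar_full {f : R →+* S} (hf : Continuous f)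
    (hfull : (restrictSepar f hf).Full) {T : Type u} [Ring T] [UniformSpace T]
    [IsUniformAddGroup T]
    [IsTopologicalRing T] [CompleteSpace T] [T2Space T] [IsLinearTopology Tᵐᵒᵖ T]
    [DiscreteTopology T] {φ ψ : S →+* T} (hφ : Continuous φ) (hψ : Continuous ψ)
    (h : ∀ r, φ (f r) = ψ (f r)) : φ = ψ := by
  have hmap : ∀ a : ZeroFam R (ZeroFam T PUnit), mapCoeff φ hφ (mapCoeff f hf a) =
      mapCoeff ψ hψ (mapCoeff f hf a) := fun a => ZeroFam.ext' fun x => h (a x)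
  have hu : ∀ a : ZeroFam R (ZeroFam T PUnit),
      join (mapCoeff ψ hψ (mapCoeff f hf (ZeroFam.map id a))) =
        join (mapCoeff φ hφ (mapCoeff f hf a)) := fun a => by
    rw [Contramodules.map_id, hmap]
  let u : (restrictSepar f hf).obj (discreteSepar φ hφ) ⟶
      (restrictSepar f hf).obj (discreteSepar ψ hψ) :=
    ObjectProperty.homMk ⟨↾id, Contramodules.hom_ext hu⟩
  obtain ⟨v, hv⟩ := hfull.map_surjective u
  have hvf : v.hom.f = ↾id := congrArg (fun w => w.hom.f) hv
  have hact : ∀ a : ZeroFam S (ZeroFam T PUnit), join (mapCoeff ψ hψ a) =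
      join (mapCoeff φ hφ a) := fun a => by
    have h1 := v.hom.h
    rw [hvf] at h1
    have h2 : join (mapCoeff ψ hψ (ZeroFam.map id a)) = join (mapCoeff φ hφ a) :=
      ConcreteCategory.congr_hom h1 a
    rwa [Contramodules.map_id] at h2
  -- The action of `s` on the free generator recovers `χ s`.
  have hval : ∀ (χ : S →+* T) (hχ : Continuous χ) (s : S),
      join (mapCoeff χ hχ (s • single (single PUnit.unit))) PUnit.unit = χ s := fun χ hχ s => by
    have h1 : mapCoeff χ hχ (s • single (single PUnit.unit)) =
        χ s • single (single PUnit.unit : ZeroFam T PUnit) := by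
      rw [← mapCoeff_single χ hχ (single PUnit.unit : ZeroFam T PUnit)]
      exact ZeroFam.ext' fun x => map_mul χ _ _
    rw [h1, join_smul, join_single, ZeroFam.smul_apply, single_self, mul_one]
  ext s
  rw [← hval φ hφ, ← hval ψ hψ, hact]

/-- An arbitrary test ring `T` is given the discrete topology; maps `S → S / J → T` are then
continuous because they vanish on the open ideal `J`. -/
theorem isProepimorphism_of_restrictSepar_full {f : R →+* S} (hf : Continuous f)
    (hfull : (restrictSepar f hf).Full) : IsProepimorphism f := by
  refine fun I J hI hJ hIJ => ⟨fun {T} g g' hgg' => ?_⟩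
  let _ : UniformSpace T := ⊥
  have : DiscreteTopology T := ⟨rfl⟩
  have hcont : ∀ χ : J.ringCon.Quotient →+* T, Continuous (χ.comp J.ringCon.mk') := fun χ => by
    refine continuous_of_continuousAt_zero (χ.comp J.ringCon.mk') ?_
    rw [ContinuousAt, nhds_discrete T, tendsto_pure]
    filter_upwards [hJ.mem_nhds J.zero_mem] with s hs
    rw [map_zero]
    have h1 : J.ringCon.mk' s = J.ringCon.mk' 0 :=
      (RingCon.eq J.ringCon).2 ((J.rel_iff _ _).2 (by simpa using hs))
    rw [RingHom.comp_apply, h1, map_zero, map_zero]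
  have key := hom_eq_of_restrictSepar_full hf hfull (hcont g.hom) (hcont g'.hom) fun r =>
    RingHom.congr_fun (congrArg RingCat.Hom.hom hgg') (I.ringCon.mk' r)
  ext s
  exact RingHom.congr_fun key s

end Contramodules

theorem mainTheorem8 {R S : Type u}
    [Ring R] [UniformSpace R] [IsUniformAddGroup R] [IsTopologicalRing R]
    [CompleteSpace R] [T2Space R] [IsLinearTopology R R] [IsLinearTopology Rᵐᵒᵖ R]
    [Ring S] [UniformSpace S] [IsUniformAddGroup S] [IsTopologicalRing S]
    [CompleteSpace S] [T2Space S] [IsLinearTopology S S] [IsLinearTopology Sᵐᵒᵖ S]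
    (hR : (𝓝 (0 : R)).IsCountablyGenerated) (hS : (𝓝 (0 : S)).IsCountablyGenerated)
    (f : R →+* S) (hf : Continuous f) (htaut : Contramodules.StronglyRightTaut f) :
    ((Contramodules.restrictSepar f hf).Full ∧ (Contramodules.restrictSepar f hf).Faithful) ↔
      Contramodules.IsProepimorphism f :=
  ⟨fun h => Contramodules.isProepimorphism_of_restrictSepar_full hf h.1,
    fun h => ⟨h.restrictSepar_full hf htaut hR, Contramodules.restrictSepar_faithful f hf⟩⟩
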